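/- Let $S^1\subset\mathbb C$ be the unit circle and let $G=\mathbb R/\mathbb Z\rtimes\{1,-1\}$, with elements written $e^tv$, act on $S^1$ by $e^t1(x)=x\,e^{2\pi i t}$ and $e^t(-1)(x)=\overline{x}\,e^{2\pi i t}$, and on the torus $T=S^1\times S^1$ by $e^tv(x,y)=(vx,\,e^tv(y))$, where $vx=e^0v(x)$. Let $K=\{e^{2\pi i t}:0\le t<\tfrac12\}$, $D=S^1\setminus K$, $X[\epsilon]=S^1\times K$ (the consonant intervals), $D[\epsilon]=S^1\times D$, and $q=e^{1/2}1$, which acts by $(x,y)\mapsto(x,-y)$. For $\xi\in X[\epsilon]$ call $g\in G$ *admissible for $\xi$* if $\xi\in g(D[\epsilon])$ and $g$ commutes with $q$ as a map of $T$. Let $\tau_q$ be the topology on $T$ given by the Kuratowski closure operator $A\mapsto \overline{A}\cup q(\overline{A})$, where $\overline{A}$ is the closure in the standard topology. 1. After identification of topologically indistinguishable points (that is, of $z$ with $q(z)$), $(T,\tau_q)$ is homeomorphic to $T$ with its standard topology; under the same identification each section $\{x\}\times S^1$, as a subspace of $(T,\tau_q)$, is homeomorphic to the real projective line $\mathbb{RP}^1$;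 and $\mathbb{RP}^1$ is homeomorphic to $S^1$. 2. For $g\in G$: $g(X[\epsilon])=D[\epsilon]$ if and only if $g=q$, and $g(X[\epsilon])\cap X[\epsilon]=\emptyset$ if and only if $g=q$. 3. Let $T$ carry either the standard topology or $\tau_q$, and let $\xi=(x,k)\in X[\epsilon]$. - For every $g\ne q$ admissible for $\xi$, the subspace $g(X[\epsilon])\cap X[\epsilon]$ is homotopy equivalent to $S^1$, and its first singular homology group satisfies $H_1(g(X[\epsilon])\cap X[\epsilon];\mathbb Z)\cong\mathbb Z$. - Call $g$ a *homological counterpoint symmetry of $\xi$* if $g$ is admissible for $\xi$ and the rank of $H_1(g(X[\epsilon])\cap X[\epsilon];\mathbb Z)$ is maximal among all elements admissible for $\xi$. These symmetries are exactly the $g\neq q$ admissible for $\xi$. - Call the members of $g(X[\epsilon])\cap X[\epsilon]$, for $g$ a homological counterpoint symmetry of $\xi$, the *admitted successors* of $\xi$. The set of all admitted successors of $\xi$ is $S^1\times(K\setminus\{k\})$: every consonant interval is admitted, over every cantus firmus, except the given discantus interval $k$ itself. -/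

import Mathlib

open scoped ContinuousMap

noncomputable section

namespace ContinuousCounterpoint

/-! ### The group `G = ℝ/ℤ ⋊ ℤ₂` and its actions -/

/-- The action of `ℤ₂ = {1, -1}` on `ℝ/ℤ` by `t ↦ v t`. -/
def signAut : ℤˣ →* MulAut (Multiplicative UnitAddCircle) where
  toFun v :=
    { toFun := fun t => t ^ (v : ℤ)
      invFun := fun t => t ^ (v : ℤ)
      left_inv := fun t => by
        rcases Int.units_eq_one_or v with rfl | rfl <;> simp
      right_inv := fun t => by
        rcases Int.units_eq_one_or v with rfl | rfl <;> simp
      map_mul' := fun s t => mul_zpow s t (v : ℤ) }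
  map_one' := by ext t; simp
  map_mul' v w := by
    ext t
    change t ^ ((v * w : ℤˣ) : ℤ) = (t ^ (w : ℤ)) ^ (v : ℤ)
    rw [← zpow_mul, mul_comm, Units.val_mul]

/-- The group `G = ℝ/ℤ ⋊ ℤ₂`. -/
abbrev G : Type := Multiplicative UnitAddCircle ⋊[signAut] ℤˣ

/-- The element `e^t v` of `G`. -/
def affine (t : ℝ) (v : ℤˣ) : G := ⟨Multiplicative.ofAdd (t : UnitAddCircle), v⟩

/-- The linear part `v` acting on `S¹`: the identity for `v = 1`, and complex conjugation
(which on `S¹` is inversion) for `v = -1`. -/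
def lin (v : ℤˣ) (x : Circle) : Circle := x ^ (v : ℤ)

/-- The action of `G` on `S¹`: `e^t v (x) = (v x) exp (2 π i t)`. -/
def circleAct (g : G) (x : Circle) : Circle :=
  lin g.right x * AddCircle.toCircle (Multiplicative.toAdd g.left)

/-- The torus `T = S¹ × S¹`; first component the cantus firmus, second the discantus interval. -/
abbrev Torus : Type := Circle × Circle

/-- The underlying map of the action of `G` on `T`: `e^t v (x, y) = (v x, e^t v (y))`. -/
def torusFun (g : G) (z : Torus) : Torus := (lin g.right z.1, circleAct g z.2)

theorem torusFun_one (z : Torus) : torusFun 1 z = z := by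
  simp [torusFun, lin, circleAct]

theorem torusFun_mul (g h : G) (z : Torus) : torusFun (g * h) z = torusFun g (torusFun h z) := by
  have key : AddCircle.toCircle (Multiplicative.toAdd (signAut g.right h.left)) =
      AddCircle.toCircle (Multiplicative.toAdd h.left) ^ ((g.right : ℤˣ) : ℤ) := by
    rw [← AddCircle.toCircle_zsmul]
    rfl
  ext1
  · simp [torusFun, lin, ← zpow_mul, mul_comm]
  · simp only [torusFun, lin, circleAct, SemidirectProduct.mul_left, SemidirectProduct.mul_right,
      toAdd_mul, AddCircle.toCircle_add, key, mul_zpow, Units.val_mul, ← zpow_mul]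
    rw [mul_comm (g.right : ℤ) (h.right : ℤ)]
    simp only [mul_comm, mul_left_comm]

theorem continuous_torusFun (g : G) : Continuous (torusFun g) := by
  unfold torusFun circleAct lin
  fun_prop

/-- The action of `G` on `T` by homeomorphisms. -/
def torusAct : G →* (Torus ≃ₜ Torus) where
  toFun g :=
    { toFun := torusFun g
      invFun := torusFun g⁻¹
      left_inv := fun z => by rw [← torusFun_mul, inv_mul_cancel, torusFun_one]
      right_inv := fun z => by rw [← torusFun_mul, mul_inv_cancel, torusFun_one]
      continuous_toFun := continuous_torusFun g
      continuous_invFun := continuous_torusFun g⁻¹ }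
  map_one' := by ext1 z; exact torusFun_one z
  map_mul' g h := by ext1 z; exact torusFun_mul g h z

/-! ### Consonances, dissonances and the quasipolarity -/

/-- The consonances: the image of `[0, 1/2)` under `t ↦ exp (2 π i t)`. -/
def K : Set Circle := (fun t : ℝ => Circle.exp (2 * Real.pi * t)) '' Set.Ico 0 (1 / 2)

/-- The dissonances. -/
def D : Set Circle := Kᶜ

/-- The consonant intervals `X[ε] = S¹ × K`. -/
def Keps : Set Torus := Set.univ ×ˢ K

/-- The dissonant intervals `S¹ × D`. -/
def Deps : Set Torus := Set.univ ×ˢ D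

/-- The element `e^{1/2} 1` of `G`. -/
def quasipolarity : G := affine (1 / 2) 1

/-- `g X[ε] ∩ X[ε]`. -/
def successorSet (g : G) : Set Torus := (torusAct g '' Keps) ∩ Keps

/-- The first two conditions on a counterpoint symmetry of `ξ`: `ξ ∈ g (D[ε])`, and `g` commutes
with the quasipolarity. -/
structure Admissible (ξ : Torus) (g : G) : Prop where
  mem : ξ ∈ torusAct g '' Deps
  comm : Commute (torusAct g) (torusAct quasipolarity)

/-! ### Kuratowski closure operators -/

/-- A Kuratowski closure operator on a set. -/
structure KuratowskiClosure (X : Type) where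
  cl : Set X → Set X
  cl_empty : cl ∅ = ∅
  subset_cl : ∀ A, A ⊆ cl A
  cl_union : ∀ A B, cl (A ∪ B) = cl A ∪ cl B
  cl_cl : ∀ A, cl (cl A) = cl A

namespace KuratowskiClosure

variable {X : Type}

theorem cl_mono (c : KuratowskiClosure X) {A B : Set X} (h : A ⊆ B) : c.cl A ⊆ c.cl B := by
  rw [← Set.union_eq_self_of_subset_left h, c.cl_union]
  exact Set.subset_union_left

/-- The topology of a Kuratowski closure operator: the closed sets are the fixed points. -/
@[reducible] def topology (c : KuratowskiClosure X) : TopologicalSpace X :=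
  TopologicalSpace.ofClosed {A | c.cl A = A} c.cl_empty
    (fun 𝒜 h𝒜 => Set.Subset.antisymm
      (Set.subset_sInter fun A hA => (c.cl_mono (Set.sInter_subset_of_mem hA)).trans (h𝒜 hA).le)
      (c.subset_cl _))
    (fun A hA B hB => by
      have hA : c.cl A = A := hA
      have hB : c.cl B = B := hB
      change c.cl (A ∪ B) = A ∪ B
      rw [c.cl_union, hA, hB])

/-- The Kuratowski closure operator `A ↦ cl A ∪ p (cl A)` induced by an involutive
homeomorphism `p` of a topological space. -/
def ofInvolution [TopologicalSpace X] (p : X ≃ₜ X) (hp : Function.Involutive p) :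
    KuratowskiClosure X where
  cl A := closure A ∪ p '' closure A
  cl_empty := by simp
  subset_cl A := subset_closure.trans Set.subset_union_left
  cl_union A B := by
    rw [closure_union, Set.image_union, Set.union_union_union_comm]
  cl_cl A := by
    have h1 : closure (closure A ∪ p '' closure A) = closure A ∪ p '' closure A :=
      (isClosed_closure.union (p.isClosedMap _ isClosed_closure)).closure_eq
    have h2 : p '' (p '' closure A) = closure A := by
      rw [Set.image_image]
      simp [hp _]
    rw [h1, Set.image_union, h2, Set.union_comm (p '' closure A), Set.union_self]

end KuratowskiClosure

theorem quasipolarity_mul_self : quasipolarity * quasipolarity = 1 := by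
  ext1
  · change Multiplicative.ofAdd (((1 / 2 : ℝ) : UnitAddCircle)) *
      signAut 1 (Multiplicative.ofAdd (((1 / 2 : ℝ) : UnitAddCircle))) = 1
    rw [map_one, MulAut.one_apply, ← ofAdd_add, ← AddCircle.coe_add]
    norm_num
  · rfl

theorem quasipolarity_involutive : Function.Involutive (torusAct quasipolarity) := fun z => by
  change torusFun quasipolarity (torusFun quasipolarity z) = z
  rw [← torusFun_mul, quasipolarity_mul_self, torusFun_one]

/-- The standard topology of the torus. -/
@[reducible] def standardTopology : TopologicalSpace Torus := inferInstance

/-- The topology on the torus of the Kuratowski closure operator induced by `e^{1/2} 1`. -/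
@[reducible] def kuratowskiTopology : TopologicalSpace Torus :=
  (KuratowskiClosure.ofInvolution (torusAct quasipolarity) quasipolarity_involutive).topology

/-- The set `T` endowed with the topology `τ`. -/
def TorusWith (_ : TopologicalSpace Torus) : Type := Torus

instance (τ : TopologicalSpace Torus) : TopologicalSpace (TorusWith τ) := τ

/-- A point of `T` endowed with `τ`, as a point of `T`. -/
def TorusWith.point {τ : TopologicalSpace Torus} (z : TorusWith τ) : Torus := z

/-- A subset `A` of `T`, as a subspace of `T` endowed with `τ`. -/
abbrev SubspaceOf (τ : TopologicalSpace Torus) (A : Set Torus) : Type :=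
  {z : TorusWith τ // z.point ∈ A}

/-- The section `{x} × S¹` of the torus. -/
def fibre (x : Circle) : Set Torus := {x} ×ˢ Set.univ

/-- The real projective line: lines in `ℝ²`, with the quotient topology from `ℝ² \ {0}`. -/
def RP1 : Type := Projectivization ℝ (Fin 2 → ℝ)

instance : TopologicalSpace RP1 :=
  TopologicalSpace.coinduced (Projectivization.mk' ℝ : {v : Fin 2 → ℝ // v ≠ 0} → _) inferInstance

/-! ### Homology and counterpoint symmetries -/

/-- First singular homology with integer coefficients. -/
def H1 (Y : Type) [TopologicalSpace Y] : ModuleCat.{0} ℤ :=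
  ((AlgebraicTopology.singularHomologyFunctor (ModuleCat.{0} ℤ) 1).obj (ModuleCat.of ℤ ℤ)).obj
    (TopCat.of Y)

/-- Counterpoint symmetries of `ξ` in the homological sense: maximization of cardinality is
replaced by maximization of the rank of `H₁ (g X[ε] ∩ X[ε])`. -/
structure IsHomologicalSymmetry (τ : TopologicalSpace Torus) (ξ : Torus) (g : G) : Prop where
  admissible : Admissible ξ g
  maximal : ∀ h : G, Admissible ξ h →
    Module.rank ℤ (H1 (SubspaceOf τ (successorSet h))) ≤
      Module.rank ℤ (H1 (SubspaceOf τ (successorSet g)))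

/-- The admitted successors of `ξ`: the members of `g X[ε] ∩ X[ε]`, where `g` runs through the
counterpoint symmetries of `ξ` in the homological sense. -/
def admittedSuccessors (τ : TopologicalSpace Torus) (ξ : Torus) : Set Torus :=
  {z | ∃ g : G, IsHomologicalSymmetry τ ξ g ∧ z ∈ successorSet g}

end ContinuousCounterpoint

end

/-! Each `g` acts on `T` as a bijection in the first coordinate and as an isometry of the circle in
the second, so `g X[ε] ∩ X[ε] = S¹ × J` with `J = gK ∩ K`. In the coordinate `s` modulo 1, `gK` is a
half-open half circle, `[t, t + 1/2)` or `(t - 1/2, t]`. It meets `K` in a connected set, which is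
empty only for `q` (`isPreconnected_translate_inter_K`, `translate_inter_K_nonempty`). Since `q` is
central, admissibility of `g` for `(x, k)` just says `k ∉ gK` (`admissible_iff`).

The topology `τ_q` is induced by `(x, y) ↦ (x, y²)` (`kuratowskiTopology_eq`), which gives the
separation quotients; `ℝP¹` is a circle through `z ↦ conj z / z`. Squaring is injective on `K`, so
in both topologies the intersection is `S¹ × p(J)`, with `p` the identity or squaring. For
admissible `g ≠ q` the set `p(J)` is nonempty, connected and misses `p(k)`, hence is contractible,
and the product is homotopy equivalent to `S¹`.

`H₁(S¹) ≅ ℤ` comes from the covering `ℝ → S¹`: singular chains of the circle are the coinvariants of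
those of the line under translation (`shortExact_cover`), and the connecting map identifies `H₁(S¹)`
with `H₀(ℝ)`. Hence the rank is 1 for every admissible `g ≠ q` and 0 for `q`. Finally, each point of
`K` other than `k` lies in some `gK` avoiding `k` (`exists_translate`). -/

section FreeOrbits

/-! ### Coinvariants of a free `ℤ`-action on finitely supported functions. -/

variable {E B : Type*}

/-- If no power of `T` other than the identity has a fixed point, then `T_* - 1` is injective on
finitely supported functions. -/
theorem Finsupp.lmapDomain_sub_id_injective (T : Equiv.Perm E)
    (hT : ∀ e, Function.Injective fun n : ℤ => (T ^ n) e) :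
    Function.Injective
      (Finsupp.lmapDomain ℤ ℤ T - LinearMap.id : (E →₀ ℤ) →ₗ[ℤ] (E →₀ ℤ)) := by
  rw [← LinearMap.ker_eq_bot, LinearMap.ker_eq_bot']
  intro x hx
  have h1 : Finsupp.mapDomain T x = x := by
    simpa [sub_eq_zero, Finsupp.lmapDomain_apply] using hx
  have h2 : ∀ e, x (T e) = x e := fun e => by
    conv_lhs => rw [← h1]
    exact Finsupp.mapDomain_apply T.injective x e
  have h3 : ∀ (e : E) (n : ℕ), x ((T ^ (n : ℤ)) e) = x e := fun e n => by
    induction n with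
    | zero => simp
    | succ k ih =>
      rw [← ih, Nat.cast_succ, add_comm, zpow_add, zpow_one, Equiv.Perm.mul_apply, h2]
  by_contra hne
  obtain ⟨e, he⟩ := Finsupp.ne_iff.mp hne
  -- A fixed vector is constant along orbits; a nonzero value would put an infinite orbit into a
  -- finite support.
  refine Set.infinite_of_injective_forall_mem (s := (x.support : Set E))
    (f := fun n : ℕ => (T ^ (n : ℤ)) e) (fun m n hmn => ?_) (fun n => ?_) x.support.finite_toSet
  · exact_mod_cast hT e hmn
  · simpa only [Finset.mem_coe, Finsupp.mem_support_iff, h3, Finsupp.coe_zero, Pi.zero_apply]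
      using he

/-- If the fibres of the surjection `p` are the orbits of `T`, then the kernel of `p_*` is the range
of `T_* - 1`. -/
theorem Finsupp.exact_lmapDomain_sub_id (T : Equiv.Perm E) (p : E → B)
    (hp : Function.Surjective p) (hTp : ∀ a b, p a = p b ↔ ∃ n : ℤ, (T ^ n) a = b) :
    Function.Exact (Finsupp.lmapDomain ℤ ℤ T - LinearMap.id : (E →₀ ℤ) →ₗ[ℤ] (E →₀ ℤ))
      (Finsupp.lmapDomain ℤ ℤ p) := by
  set R := LinearMap.range
    (Finsupp.lmapDomain ℤ ℤ T - LinearMap.id : (E →₀ ℤ) →ₗ[ℤ] (E →₀ ℤ)) with hR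
  have h1 : ∀ (a : E) (c : ℤ), Finsupp.single (T a) c - Finsupp.single a c ∈ R := fun a c =>
    ⟨Finsupp.single a c, by simp [Finsupp.mapDomain_single]⟩
  have h2 : ∀ (n : ℤ) (a : E) (c : ℤ), Finsupp.single ((T ^ n) a) c - Finsupp.single a c ∈ R := by
    intro n a c
    induction n with
    | zero => simp
    | succ k ih =>
      have := R.add_mem (h1 ((T ^ (k : ℤ)) a) c) ih
      rw [add_comm, zpow_add, zpow_one, Equiv.Perm.mul_apply]
      simpa using this
    | pred k ih =>
      have := R.sub_mem ih (h1 ((T ^ (-(k : ℤ) - 1)) a) c)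
      rw [← Equiv.Perm.mul_apply, ← zpow_one_add, add_sub_cancel] at this
      simpa using this
  obtain ⟨s, hs⟩ := hp.hasRightInverse
  -- Modulo the range, each generator equals the chosen representative of its fibre, so `x` is
  -- congruent to `s_* p_* x`, which vanishes when `p_* x = 0`.
  have h3 : ∀ x : E →₀ ℤ, x - Finsupp.mapDomain s (Finsupp.mapDomain p x) ∈ R := by
    intro x
    induction x using Finsupp.induction_linear with
    | zero => simp
    | add x y hx hy =>
      have := R.add_mem hx hy
      rw [Finsupp.mapDomain_add, Finsupp.mapDomain_add]
      convert this using 1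
      abel
    | single a c =>
      rw [Finsupp.mapDomain_single, Finsupp.mapDomain_single]
      obtain ⟨n, hn⟩ := (hTp (s (p a)) a).1 (hs _)
      simpa only [hn] using h2 n (s (p a)) c
  intro x
  constructor
  · intro hx
    have := h3 x
    rw [show Finsupp.mapDomain p x = 0 from hx, Finsupp.mapDomain_zero, sub_zero] at this
    exact this
  · rintro ⟨y, rfl⟩
    have : p ∘ T = p := by
      ext a
      exact ((hTp a (T a)).2 ⟨1, by simp⟩).symm
    rw [LinearMap.sub_apply, map_sub, sub_eq_zero]
    simp only [Finsupp.lmapDomain_apply, LinearMap.id_apply]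
    rw [← Finsupp.mapDomain_comp, this]

end FreeOrbits

section Homology

open CategoryTheory Limits AlgebraicTopology Simplicial

/-! ### Simplicial chains and free automorphisms. -/

namespace SSet

variable (X Y Z : SSet.{0})

/-- The finitely supported functions on `S` are the coproduct of copies of `ℤ` indexed by `S`. -/
noncomputable def _root_.ModuleCat.isColimitFinsuppCofan (S : Type) :
    IsColimit (Cofan.mk (f := fun _ : S => ModuleCat.of ℤ ℤ) (ModuleCat.of ℤ (S →₀ ℤ))
      fun x => ModuleCat.ofHom (Finsupp.lsingle x)) :=
  Cofan.IsColimit.mk _ (fun s => ModuleCat.ofHom (Finsupp.lsum ℕ fun x => (s.inj x).hom))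
    (fun s x => by
      ext
      simp)
    (fun s m h => by
      apply ModuleCat.hom_ext
      refine Finsupp.lhom_ext' fun x => ?_
      have hx : m.hom ∘ₗ Finsupp.lsingle x = (s.inj x).hom := congrArg ModuleCat.Hom.hom (h x)
      rw [hx]
      ext
      simp)

/-- The integral chains of a simplicial set as finitely supported functions on its simplices. -/
noncomputable def chainsIsoFinsupp (n : ℕ) :
    (X.chainComplex (ModuleCat.of ℤ ℤ)).X n ≅ ModuleCat.of ℤ (X _⦋n⦌ →₀ ℤ) :=
  (X.isColimitChainComplexXCofan (ModuleCat.of ℤ ℤ) n).coconePointUniqueUpToIso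
    (ModuleCat.isColimitFinsuppCofan (X _⦋n⦌))

theorem ι_chainsIsoFinsupp_hom (n : ℕ) (x : X _⦋n⦌) :
    X.ιChainComplex x ≫ (X.chainsIsoFinsupp n).hom = ModuleCat.ofHom (Finsupp.lsingle x) :=
  IsColimit.comp_coconePointUniqueUpToIso_hom
    (X.isColimitChainComplexXCofan (ModuleCat.of ℤ ℤ) n) _ ⟨x⟩

variable {X Y Z}

/-- Naturality of `chainsIsoFinsupp`: it turns the degreewise exactness of chain complexes into the
statements on `Finsupp.lmapDomain`. -/
theorem chainComplexMap_chainsIsoFinsupp (f : X ⟶ Y) (n : ℕ) :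
    (chainComplexMap f (ModuleCat.of ℤ ℤ)).f n ≫ (Y.chainsIsoFinsupp n).hom =
      (X.chainsIsoFinsupp n).hom ≫ ModuleCat.ofHom (Finsupp.lmapDomain ℤ ℤ (f.app (.op ⦋n⦌))) := by
  refine chainComplex_hom_ext fun x => ?_
  rw [ι_chainComplexMap_f_assoc, ι_chainsIsoFinsupp_hom, ← Category.assoc, ι_chainsIsoFinsupp_hom]
  ext
  simp [Finsupp.lmapDomain_apply]

/-- Let `p : X ⟶ Y` be a surjective morphism of simplicial sets whose fibres are the orbits of an
automorphism `T` of `X` all of whose nonzero powers act without fixed simplices. Then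
`0 → C(X) → C(X) → C(Y) → 0`, with maps `T_* - 1` and `p_*`, is exact. -/
theorem shortExact_chainComplexMap_sub_id (T : X ≅ X) (p : X ⟶ Y) (w : T.hom ≫ p = p)
    (hT : ∀ n (e : X _⦋n⦌),
      Function.Injective fun k : ℤ => ((((T.app (.op ⦋n⦌)).toEquiv : Equiv.Perm _) ^ k) e))
    (hp : ∀ n, Function.Surjective (p.app (.op ⦋n⦌)))
    (hTp : ∀ n (a b : X _⦋n⦌), p.app (.op ⦋n⦌) a = p.app (.op ⦋n⦌) b →
      ∃ k : ℤ, (((T.app (.op ⦋n⦌)).toEquiv : Equiv.Perm _) ^ k) a = b) :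
    (ShortComplex.mk (chainComplexMap T.hom (ModuleCat.of ℤ ℤ) - 𝟙 _)
      (chainComplexMap p (ModuleCat.of ℤ ℤ))
      (by rw [Preadditive.sub_comp, ← Functor.map_comp, w, Category.id_comp, sub_self])).ShortExact := by
  refine HomologicalComplex.shortExact_of_degreewise_shortExact _ fun n => ?_
  let τ : Equiv.Perm (X _⦋n⦌) := (T.app (.op ⦋n⦌)).toEquiv
  have hTp' : ∀ a b, p.app (.op ⦋n⦌) a = p.app (.op ⦋n⦌) b ↔ ∃ k : ℤ, (τ ^ k) a = b := by
    refine fun a b => ⟨hTp n a b, ?_⟩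
    have h1 : ∀ a, p.app (.op ⦋n⦌) (τ a) = p.app (.op ⦋n⦌) a := fun a =>
      congrArg (fun f : X ⟶ Y => f.app (.op ⦋n⦌) a) w
    have h2 : ∀ (k : ℤ) a, p.app (.op ⦋n⦌) ((τ ^ k) a) = p.app (.op ⦋n⦌) a := by
      intro k a
      induction k with
      | zero => rfl
      | succ k ih => rw [add_comm, zpow_add, zpow_one, Equiv.Perm.mul_apply, h1, ih]
      | pred k ih =>
        rw [← ih, ← h1 ((τ ^ (-(k : ℤ) - 1)) a), ← Equiv.Perm.mul_apply, ← zpow_one_add,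
          add_sub_cancel]
    rintro ⟨k, rfl⟩
    exact (h2 k a).symm
  have hex := Finsupp.exact_lmapDomain_sub_id τ (p.app (.op ⦋n⦌)) (hp n) hTp'
  have hinj := Finsupp.lmapDomain_sub_id_injective τ (hT n)
  have hsurj := Finsupp.mapDomain_surjective (M := ℤ) (hp n)
  let S : ShortComplex (ModuleCat.{0} ℤ) := ShortComplex.mk
    (ModuleCat.ofHom (Finsupp.lmapDomain ℤ ℤ τ - LinearMap.id : (X _⦋n⦌ →₀ ℤ) →ₗ[ℤ] (X _⦋n⦌ →₀ ℤ)))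
    (ModuleCat.ofHom (Finsupp.lmapDomain ℤ ℤ (p.app (.op ⦋n⦌)))) (by
      apply ModuleCat.hom_ext
      exact LinearMap.ext hex.apply_apply_eq_zero)
  have hS : S.ShortExact :=
    { exact := (ShortComplex.ShortExact.moduleCat_exact_iff_function_exact S).2 hex
      mono_f := (ModuleCat.mono_iff_injective _).2 hinj
      epi_g := (ModuleCat.epi_iff_surjective _).2 hsurj }
  refine ShortComplex.shortExact_of_iso (ShortComplex.isoMk (X.chainsIsoFinsupp n)
    (X.chainsIsoFinsupp n) (Y.chainsIsoFinsupp n) ?_ ?_).symm hS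
  · have := chainComplexMap_chainsIsoFinsupp T.hom n
    change (X.chainsIsoFinsupp n).hom ≫
      (ModuleCat.ofHom (Finsupp.lmapDomain ℤ ℤ (T.hom.app (.op ⦋n⦌))) - 𝟙 _) =
      ((chainComplexMap T.hom (ModuleCat.of ℤ ℤ)).f n - 𝟙 _) ≫ (X.chainsIsoFinsupp n).hom
    rw [Preadditive.comp_sub, Preadditive.sub_comp, this, Category.id_comp, Category.comp_id]
  · exact (chainComplexMap_chainsIsoFinsupp p n).symm

end SSet

/-! ### Singular simplices of the circle and their lifts to the line. -/

namespace CircleHomology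

/-- Translation of the line by `2 * π`. -/
noncomputable def shift : TopCat.of ℝ ≅ TopCat.of ℝ :=
  TopCat.isoOfHomeo (Homeomorph.addRight (2 * Real.pi))

/-- The universal covering of the circle. -/
noncomputable def cover : TopCat.of ℝ ⟶ TopCat.of Circle :=
  TopCat.ofHom ⟨Circle.exp, Circle.exp.continuous⟩

theorem shift_cover : shift.hom ≫ cover = cover := by
  ext x : 1
  change Circle.exp (x + 2 * Real.pi) = Circle.exp x
  simp

/-- Translation by `2 * π` of the singular simplices of the line. -/
noncomputable def shiftPerm (n : ℕ) : Equiv.Perm ((TopCat.toSSet.obj (TopCat.of ℝ)) _⦋n⦌) :=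
  ((TopCat.toSSet.mapIso shift).app (.op ⦋n⦌)).toEquiv

theorem toSSetObjEquiv_shiftPerm (n : ℕ) (σ) (x) :
    TopCat.toSSetObjEquiv (TopCat.of ℝ) (.op ⦋n⦌) (shiftPerm n σ) x =
      (TopCat.toSSetObjEquiv (TopCat.of ℝ) (.op ⦋n⦌) σ x : ℝ) + 2 * Real.pi :=
  rfl

theorem toSSetObjEquiv_shiftPerm_zpow (n : ℕ) (k : ℤ) (σ) (x) :
    TopCat.toSSetObjEquiv (TopCat.of ℝ) (.op ⦋n⦌) ((shiftPerm n ^ k) σ) x =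
      (TopCat.toSSetObjEquiv (TopCat.of ℝ) (.op ⦋n⦌) σ x : ℝ) + k * (2 * Real.pi) := by
  induction k with
  | zero => simp
  | succ k ih =>
    rw [add_comm (k : ℤ) 1, zpow_one_add, Equiv.Perm.mul_apply, toSSetObjEquiv_shiftPerm, ih]
    push_cast
    ring
  | pred k ih =>
    have := toSSetObjEquiv_shiftPerm n ((shiftPerm n ^ (-(k : ℤ) - 1)) σ) x
    rw [← Equiv.Perm.mul_apply, ← zpow_one_add, add_sub_cancel, ih] at this
    push_cast at this ⊢
    linarith

theorem toSSetObjEquiv_map_cover (n : ℕ) (σ) (x) :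
    TopCat.toSSetObjEquiv (TopCat.of Circle) (.op ⦋n⦌)
      ((TopCat.toSSet.map cover).app (.op ⦋n⦌) σ) x =
      Circle.exp (TopCat.toSSetObjEquiv (TopCat.of ℝ) (.op ⦋n⦌) σ x : ℝ) :=
  rfl

theorem toSSet_map_cover_surjective (n : ℕ) :
    Function.Surjective ((TopCat.toSSet.map cover).app (.op ⦋n⦌)) := by
  intro σ
  have hc := convex_stdSimplex ℝ (Fin (n + 1))
  -- The lifting criterion needs a simply connected, locally path connected source; a simplex is
  -- both because it is convex.
  have : LocallyPathConnectedSpace (stdSimplex ℝ (Fin (n + 1))) := hc.locallyPathConnectedSpace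
  have : ContractibleSpace (stdSimplex ℝ (Fin (n + 1))) :=
    hc.contractibleSpace ⟨_, (stdSimplex.vertex 0).2⟩
  let s : C(stdSimplex ℝ (Fin (n + 1)), Circle) :=
    TopCat.toSSetObjEquiv (TopCat.of Circle) (.op ⦋n⦌) σ
  obtain ⟨F, ⟨-, hF⟩, -⟩ := Circle.isCoveringMap_exp.existsUnique_continuousMap_lifts s
    (stdSimplex.vertex 0) (Complex.arg (s (stdSimplex.vertex 0))) (Circle.exp_arg _)
  refine ⟨(TopCat.toSSetObjEquiv (TopCat.of ℝ) (.op ⦋n⦌)).symm F, ?_⟩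
  apply (TopCat.toSSetObjEquiv (TopCat.of Circle) (.op ⦋n⦌)).injective
  ext1 x
  rw [toSSetObjEquiv_map_cover, Equiv.apply_symm_apply]
  exact congrFun hF x

theorem exists_shiftPerm_zpow_eq (n : ℕ) (a b : (TopCat.toSSet.obj (TopCat.of ℝ)) _⦋n⦌)
    (h : (TopCat.toSSet.map cover).app (.op ⦋n⦌) a = (TopCat.toSSet.map cover).app (.op ⦋n⦌) b) :
    ∃ k : ℤ, (shiftPerm n ^ k) a = b := by
  have hexp : ∀ x, Circle.exp (TopCat.toSSetObjEquiv (TopCat.of ℝ) (.op ⦋n⦌) a x : ℝ) =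
      Circle.exp (TopCat.toSSetObjEquiv (TopCat.of ℝ) (.op ⦋n⦌) b x : ℝ) := fun x => by
    rw [← toSSetObjEquiv_map_cover, h, toSSetObjEquiv_map_cover]
  -- The translation number is read off at one vertex; uniqueness of lifts extends it to the whole
  -- simplex.
  obtain ⟨k, hk⟩ := Circle.exp_eq_exp.1 (hexp (stdSimplex.vertex 0)).symm
  refine ⟨k, ?_⟩
  apply (TopCat.toSSetObjEquiv (TopCat.of ℝ) (.op ⦋n⦌)).injective
  have : PathConnectedSpace (stdSimplex ℝ (Fin (n + 1))) := inferInstance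
  refine DFunLike.coe_injective (Circle.isCoveringMap_exp.eq_of_comp_eq
    (ContinuousMap.continuous _) (ContinuousMap.continuous _) ?_ (stdSimplex.vertex 0) ?_)
  · ext1 x
    simp only [Function.comp]
    rw [← hexp]
    erw [toSSetObjEquiv_shiftPerm_zpow]
    exact Circle.exp_eq_exp.2 ⟨k, rfl⟩
  · erw [toSSetObjEquiv_shiftPerm_zpow]
    exact hk.symm

/-- The singular chains of the circle are the coinvariants of those of the line. -/
theorem shortExact_cover :
    (ShortComplex.mk (SSet.chainComplexMap (TopCat.toSSet.map shift.hom) (ModuleCat.of ℤ ℤ) - 𝟙 _)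
      (SSet.chainComplexMap (TopCat.toSSet.map cover) (ModuleCat.of ℤ ℤ)) (by
        rw [Preadditive.sub_comp, ← Functor.map_comp, ← Functor.map_comp, shift_cover,
          Category.id_comp, sub_self])).ShortExact := by
  refine SSet.shortExact_chainComplexMap_sub_id (TopCat.toSSet.mapIso shift)
    (TopCat.toSSet.map cover) ?_ (fun n e k l hkl => ?_) toSSet_map_cover_surjective
    exists_shiftPerm_zpow_eq
  · rw [Functor.mapIso_hom, ← Functor.map_comp, shift_cover]
  · have hkl : (shiftPerm n ^ k) e = (shiftPerm n ^ l) e := hkl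
    have h := toSSetObjEquiv_shiftPerm_zpow n k e (stdSimplex.vertex 0)
    rw [hkl, toSSetObjEquiv_shiftPerm_zpow, add_right_inj,
      mul_left_inj' Real.two_pi_pos.ne'] at h
    exact_mod_cast h.symm

end CircleHomology

/-- Homotopy equivalent spaces have isomorphic singular homology. -/
theorem ContinuousMap.HomotopyEquiv.nonempty_singularHomology_iso {X Y : Type} [TopologicalSpace X]
    [TopologicalSpace Y] (e : X ≃ₕ Y) (n : ℕ) :
    Nonempty
      (((singularHomologyFunctor (ModuleCat.{0} ℤ) n).obj (ModuleCat.of ℤ ℤ)).obj (TopCat.of X) ≅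
      ((singularHomologyFunctor (ModuleCat.{0} ℤ) n).obj (ModuleCat.of ℤ ℤ)).obj (TopCat.of Y)) := by
  set F := (singularHomologyFunctor (ModuleCat.{0} ℤ) n).obj (ModuleCat.of ℤ ℤ) with hF
  have key : ∀ {A B : TopCat.{0}} (f g : A ⟶ B), f.hom.Homotopic g.hom → F.map f = F.map g := by
    rintro A B f g ⟨H⟩
    exact TopCat.Homotopy.congr_homologyMap_singularChainComplexFunctor (f := f) (g := g) H _ n
  refine ⟨⟨F.map (TopCat.ofHom e.toFun), F.map (TopCat.ofHom e.invFun), ?_, ?_⟩⟩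
  · rw [← F.map_comp, ← F.map_id]
    exact key _ _ e.left_inv
  · rw [← F.map_comp, ← F.map_id]
    exact key _ _ e.right_inv

/-! ### First homology of contractible spaces, the circle and the empty space. -/

namespace ContinuousCounterpoint

theorem isZero_H1_of_contractible (X : Type) [TopologicalSpace X] [ContractibleSpace X] :
    IsZero (H1 X) := by
  obtain ⟨e⟩ := ContractibleSpace.hequiv_unit X
  obtain ⟨i⟩ := e.nonempty_singularHomology_iso 1
  exact (isZero_singularHomologyFunctor_of_totallyDisconnectedSpace (ModuleCat.{0} ℤ) 1
    (ModuleCat.of ℤ ℤ) (TopCat.of Unit) one_ne_zero).of_iso i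

-- In the long exact sequence of `shortExact_cover`, `H₁(ℝ) = 0` makes the connecting map `H₁(S¹) →
-- H₀(ℝ)` injective. Translation is homotopic to the identity, so the next map, `shift_* - 1` on
-- `H₀(ℝ)`, is zero and the connecting map is surjective. The augmentation gives `H₀(ℝ) ≅ ℤ`.
open CircleHomology in
theorem nonempty_H1_circle_iso : Nonempty (H1 Circle ≅ ModuleCat.of ℤ ℤ) := by
  have hS := shortExact_cover
  have hzero : HomologicalComplex.homologyMap
      (SSet.chainComplexMap (TopCat.toSSet.map shift.hom) (ModuleCat.of ℤ ℤ) - 𝟙 _) 0 = 0 := by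
    rw [HomologicalComplex.homologyMap_sub, sub_eq_zero]
    have H : TopCat.Homotopy shift.hom (𝟙 (TopCat.of ℝ)) :=
      ContinuousMap.Homotopy.affine _ _
    have := H.congr_homologyMap_singularChainComplexFunctor (ModuleCat.of ℤ ℤ) 0
    rw [CategoryTheory.Functor.map_id] at this
    exact this
  have hepi := (hS.homology_exact₁ 1 0 rfl).epi_f hzero
  have hmono := (hS.homology_exact₃ 1 0 rfl).mono_g
    ((isZero_H1_of_contractible ℝ).eq_of_src _ _)
  have hδ : IsIso (hS.δ 1 0 rfl) := isIso_of_mono_of_epi _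
  have : PathConnectedSpace (TopCat.of ℝ) := inferInstanceAs (PathConnectedSpace ℝ)
  have hε : IsIso (TopCat.singularHomology₀ε (TopCat.of ℝ) (ModuleCat.of ℤ ℤ)) := inferInstance
  let i := @asIso _ _ _ _ _ hδ
  let j := @asIso _ _ _ _ _ hε
  exact ⟨i ≪≫ j⟩

theorem H1_iso_of_homotopyEquiv_circle {X : Type} [TopologicalSpace X] (e : X ≃ₕ Circle) :
    Nonempty (H1 X ≅ ModuleCat.of ℤ ℤ) := by
  obtain ⟨i⟩ := e.nonempty_singularHomology_iso 1
  obtain ⟨j⟩ := nonempty_H1_circle_iso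
  exact ⟨i ≪≫ j⟩

theorem rank_eq_one_of_iso {M : ModuleCat.{0} ℤ} (e : M ≅ ModuleCat.of ℤ ℤ) :
    Module.rank ℤ M = 1 := by
  rw [e.toLinearEquiv.rank_eq]
  exact Module.rank_self ℤ

theorem rank_H1_of_isEmpty (X : Type) [TopologicalSpace X] [IsEmpty X] :
    Module.rank ℤ (H1 X) = 0 := by
  have : TotallyDisconnectedSpace (TopCat.of X) :=
    inferInstanceAs (TotallyDisconnectedSpace X)
  have h := isZero_singularHomologyFunctor_of_totallyDisconnectedSpace (ModuleCat.{0} ℤ) 1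
    (ModuleCat.of ℤ ℤ) (TopCat.of X) one_ne_zero
  have : Subsingleton (H1 X) := ModuleCat.subsingleton_of_isZero h
  exact rank_subsingleton' ℤ _

end ContinuousCounterpoint

end Homology

/-! ### Separation quotients and connected subsets of the circle. -/

section Topology

variable {X Y : Type*} [TopologicalSpace X] [TopologicalSpace Y]

/-- A surjective inducing map to a `T₀` space exhibits it as the separation quotient. -/
theorem Topology.IsInducing.nonempty_separationQuotient_homeomorph [T0Space Y] {f : X → Y}
    (hf : Topology.IsInducing f) (hs : Function.Surjective f) :
    Nonempty (SeparationQuotient X ≃ₜ Y) := by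
  let F : SeparationQuotient X → Y :=
    SeparationQuotient.lift f fun a b h => (h.map hf.continuous).eq
  have hF : Continuous F := SeparationQuotient.continuous_lift hf.continuous
  have hbij : Function.Bijective F := by
    constructor
    · intro a b
      obtain ⟨a, rfl⟩ := SeparationQuotient.surjective_mk a
      obtain ⟨b, rfl⟩ := SeparationQuotient.surjective_mk b
      intro h
      rw [SeparationQuotient.mk_eq_mk, ← hf.inseparable_iff]
      exact Inseparable.of_eq h
    · intro y
      obtain ⟨x, rfl⟩ := hs y
      exact ⟨SeparationQuotient.mk x, rfl⟩
  have hopen : IsOpenMap F := by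
    intro U hU
    obtain ⟨V, hV, hVU⟩ := hf.isOpen_iff.1 (hU.preimage SeparationQuotient.continuous_mk)
    convert hV
    ext y
    obtain ⟨x, rfl⟩ := hs y
    rw [show f x = F (SeparationQuotient.mk x) from rfl, hbij.injective.mem_set_image]
    exact (Set.ext_iff.1 hVU x).symm
  exact ⟨(Equiv.ofBijective F hbij).toHomeomorphOfContinuousOpen hF hopen⟩

end Topology

/-- A connected subset of the circle that misses a point is contractible. -/
theorem Circle.contractibleSpace_of_isConnected {S : Set Circle} (hS : IsConnected S) {c : Circle}
    (hc : c ∉ S) : ContractibleSpace S := by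
  -- Cut the circle at `c`: `Circle.exp` is injective and open on `(a, a + 2π)`, so `S` is
  -- homeomorphic to a connected, hence convex, set of reals.
  set a := Complex.arg c with ha
  have hac : Circle.exp a = c := Circle.exp_arg c
  set V : Set ℝ := Set.Ioo a (a + 2 * Real.pi) ∩ Circle.exp ⁻¹' S with hV
  have hinj : Set.InjOn Circle.exp (Set.Ioo a (a + 2 * Real.pi)) := by
    intro x hx y hy hxy
    obtain ⟨m, hm⟩ := Circle.exp_eq_exp.1 hxy
    have h1 : (m : ℝ) < 1 := by nlinarith [hx.1, hx.2, hy.1, hy.2, Real.pi_pos]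
    have h2 : (-1 : ℝ) < m := by nlinarith [hx.1, hx.2, hy.1, hy.2, Real.pi_pos]
    have h3 : m = 0 := by
      have h1' : m < 1 := by exact_mod_cast h1
      have h2' : -1 < m := by exact_mod_cast h2
      lia
    simpa [h3] using hm
  let f : V → S := fun v => ⟨Circle.exp v.1, v.2.2⟩
  have hf : Continuous f := by fun_prop
  have hfi : Function.Injective f := fun v w h =>
    Subtype.ext (hinj v.2.1 w.2.1 (congrArg Subtype.val h))
  have hfs : Function.Surjective f := by
    rintro ⟨y, hy⟩
    obtain ⟨m, hm, -⟩ := existsUnique_add_zsmul_mem_Ico Real.two_pi_pos (Complex.arg y) a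
    have hexp : Circle.exp (Complex.arg y + m • (2 * Real.pi)) = y := by
      rw [← Circle.exp_arg y]
      exact Circle.exp_eq_exp.2 ⟨m, by simp [Circle.exp_arg]⟩
    refine ⟨⟨_, ⟨lt_of_le_of_ne hm.1 fun h => hc ?_, hm.2⟩, ?_⟩, Subtype.ext hexp⟩
    · rw [← hac, h, hexp]
      exact hy
    · rw [Set.mem_preimage, hexp]
      exact hy
  have hfo : IsOpenMap f := by
    rintro U hU
    obtain ⟨W, hW, rfl⟩ := isOpen_induced_iff.1 hU
    refine isOpen_induced_iff.2 ⟨Circle.exp '' (W ∩ Set.Ioo a (a + 2 * Real.pi)),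
      isLocalHomeomorph_circleExp.isOpenMap _ (hW.inter isOpen_Ioo), ?_⟩
    ext y
    constructor
    · rintro ⟨x, hx, hxy⟩
      exact ⟨⟨x, hx.2, by rw [Set.mem_preimage, hxy]; exact y.2⟩, hx.1, Subtype.ext hxy⟩
    · rintro ⟨v, hv, rfl⟩
      exact ⟨v.1, ⟨hv, v.2.1⟩, rfl⟩
  let e : V ≃ₜ S := (Equiv.ofBijective f ⟨hfi, hfs⟩).toHomeomorphOfContinuousOpen hf hfo
  have : ConnectedSpace S := isConnected_iff_connectedSpace.1 hS
  have : ConnectedSpace V := e.symm.surjective.connectedSpace e.symm.continuous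
  have hVc : IsConnected V := isConnected_iff_connectedSpace.2 this
  have : ContractibleSpace V :=
    hVc.isPreconnected.ordConnected.convex.contractibleSpace hVc.nonempty
  exact e.symm.contractibleSpace

namespace ContinuousCounterpoint

/-! ### The projective line -/

theorem coords_ne_zero (v : {v : Fin 2 → ℝ // v ≠ 0}) : (⟨v.1 0, v.1 1⟩ : ℂ) ≠ 0 := by
  intro h
  refine v.2 (funext fun i => ?_)
  fin_cases i
  · exact congrArg Complex.re h
  · exact congrArg Complex.im h

/-- The map `z ↦ conj z / z` from nonzero vectors to the circle. -/
noncomputable def conjDivCoords (v : {v : Fin 2 → ℝ // v ≠ 0}) : Circle :=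
  Circle.ofConjDivSelf ⟨v.1 0, v.1 1⟩ (coords_ne_zero v)

theorem coe_conjDivCoords (v : {v : Fin 2 → ℝ // v ≠ 0}) :
    (conjDivCoords v : ℂ) = (starRingEnd ℂ) ⟨v.1 0, v.1 1⟩ / ⟨v.1 0, v.1 1⟩ := rfl

theorem continuous_conjDivCoords : Continuous conjDivCoords := by
  have h : Continuous fun v : {v : Fin 2 → ℝ // v ≠ 0} => (⟨v.1 0, v.1 1⟩ : ℂ) := by
    have h0 : (fun v : {v : Fin 2 → ℝ // v ≠ 0} => (⟨v.1 0, v.1 1⟩ : ℂ)) =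
        fun v => (v.1 0 : ℂ) + (v.1 1 : ℂ) * Complex.I :=
      funext fun v => Complex.mk_eq_add_mul_I _ _
    have hc : ∀ i : Fin 2, Continuous fun v : {v : Fin 2 → ℝ // v ≠ 0} => (v.1 i : ℂ) := fun i =>
      Complex.continuous_ofReal.comp ((continuous_apply i).comp continuous_subtype_val)
    rw [h0]
    exact (hc 0).add ((hc 1).mul continuous_const)
  exact continuous_induced_rng.2
    ((Complex.continuous_conj.comp h).div h coords_ne_zero)

/-- Equality of the two quotients says that `conj z * w` is real, that is, that the vectors are
parallel. -/
theorem conjDivCoords_eq_iff (v w : {v : Fin 2 → ℝ // v ≠ 0}) :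
    conjDivCoords v = conjDivCoords w ↔ v.1 0 * w.1 1 = v.1 1 * w.1 0 := by
  rw [Circle.ext_iff, coe_conjDivCoords, coe_conjDivCoords,
    div_eq_div_iff (coords_ne_zero v) (coords_ne_zero w), Complex.ext_iff]
  simp
  constructor
  · rintro ⟨-, h⟩
    linarith
  · intro h
    constructor <;> linarith

theorem mk'_eq_mk'_iff (v w : {v : Fin 2 → ℝ // v ≠ 0}) :
    Projectivization.mk' ℝ v = Projectivization.mk' ℝ w ↔ v.1 0 * w.1 1 = v.1 1 * w.1 0 := by
  rw [Projectivization.mk'_eq_mk, Projectivization.mk'_eq_mk, Projectivization.mk_eq_mk_iff']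
  constructor
  · rintro ⟨a, ha⟩
    rw [← ha]
    simp
    ring
  · intro h
    have hw : w.1 0 ^ 2 + w.1 1 ^ 2 ≠ 0 := by
      intro h0
      refine coords_ne_zero w ?_
      apply Complex.ext <;> simp <;> nlinarith [sq_nonneg (w.1 0), sq_nonneg (w.1 1)]
    -- The scalar is the coefficient of the orthogonal projection of `v` to the line of `w`.
    refine ⟨(v.1 0 * w.1 0 + v.1 1 * w.1 1) / (w.1 0 ^ 2 + w.1 1 ^ 2), funext fun i => ?_⟩
    fin_cases i
    · simp
      field_simp
      linear_combination (-w.1 1) * h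
    · simp
      field_simp
      linear_combination (w.1 0) * h

theorem nonempty_RP1_homeomorph_circle : Nonempty (RP1 ≃ₜ Circle) := by
  let π : {v : Fin 2 → ℝ // v ≠ 0} → RP1 := Projectivization.mk' ℝ
  have hπ : Continuous π := continuous_coinduced_rng
  have hπs : Function.Surjective π := Quotient.mk''_surjective
  let F : RP1 → Circle := Quotient.lift conjDivCoords fun v w h =>
    (conjDivCoords_eq_iff v w).2 ((mk'_eq_mk'_iff v w).1 (Quotient.sound h))
  have hF : Continuous F := continuous_coinduced_dom.2 continuous_conjDivCoords
  have hbij : Function.Bijective F := by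
    constructor
    · intro a b h
      obtain ⟨v, rfl⟩ := hπs a
      obtain ⟨w, rfl⟩ := hπs b
      exact (mk'_eq_mk'_iff v w).2 ((conjDivCoords_eq_iff v w).1 h)
    · intro y
      set θ := Complex.arg y
      -- For `z = exp (iφ)` one has `conj z / z = exp (-2iφ)`, hence the angle `φ = -θ / 2`.
      have hne : (![Real.cos (-θ / 2), Real.sin (-θ / 2)] : Fin 2 → ℝ) ≠ 0 := by
        intro h
        have h0 := congrFun h 0
        have h1 := congrFun h 1
        simp only [Matrix.cons_val_zero, Matrix.cons_val_one, Pi.zero_apply] at h0 h1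
        have := Real.sin_sq_add_cos_sq (-θ / 2)
        rw [h0, h1] at this
        norm_num at this
      refine ⟨π ⟨_, hne⟩, ?_⟩
      change conjDivCoords _ = y
      have hz : (⟨Real.cos (-θ / 2), Real.sin (-θ / 2)⟩ : ℂ) =
          (Circle.exp (-θ / 2) : ℂ) := by
        rw [Circle.coe_exp, Complex.exp_mul_I, ← Complex.ofReal_cos, ← Complex.ofReal_sin]
        exact Complex.mk_eq_add_mul_I _ _
      rw [← Circle.exp_arg y, Circle.ext_iff, coe_conjDivCoords]
      simp only [Matrix.cons_val_zero, Matrix.cons_val_one]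
      rw [hz, ← Circle.coe_inv_eq_conj, ← Circle.coe_div, ← Circle.exp_neg, ← Circle.exp_sub]
      congr 2
      ring
  have : CompactSpace RP1 := by
    have hs : Function.Surjective fun v : Metric.sphere (0 : Fin 2 → ℝ) 1 =>
        π ⟨v.1, fun h => by simpa [h] using v.2⟩ := by
      intro y
      obtain ⟨v, rfl⟩ := hπs y
      have hv : ‖v.1‖ ≠ 0 := norm_ne_zero_iff.2 v.2
      refine ⟨⟨‖v.1‖⁻¹ • v.1, by simp [norm_smul, hv]⟩, (mk'_eq_mk'_iff _ _).2 ?_⟩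
      simp
      ring
    exact hs.compactSpace (hπ.comp (by fun_prop))
  exact ⟨hF.homeoOfEquivCompactToT2 (f := Equiv.ofBijective F hbij)⟩

end ContinuousCounterpoint

namespace ContinuousCounterpoint

/-! ### Coordinates -/

/-- The point `exp (2 π i t)` of the circle. -/
noncomputable def e (t : ℝ) : Circle := Circle.exp (2 * Real.pi * t)

theorem continuous_e : Continuous e := by unfold e; fun_prop

theorem e_eq_e_iff {s t : ℝ} : e s = e t ↔ ∃ m : ℤ, s = t + m := by
  unfold e
  rw [Circle.exp_eq_exp]
  refine exists_congr fun m => ?_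
  have := Real.two_pi_pos.ne'
  rw [show 2 * Real.pi * t + m * (2 * Real.pi) = 2 * Real.pi * (t + m) by ring]
  exact mul_right_inj' this

theorem e_injOn : Set.InjOn e (Set.Ico 0 1) := by
  intro s hs t ht h
  obtain ⟨m, hm⟩ := e_eq_e_iff.1 h
  have h1 : (m : ℝ) < 1 := by linarith [hs.2, ht.1]
  have h2 : (-1 : ℝ) < m := by linarith [hs.1, ht.2]
  have h3 : m = 0 := by
    have h1' : m < 1 := by exact_mod_cast h1
    have h2' : -1 < m := by exact_mod_cast h2
    lia
  simpa [h3] using hm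

theorem exists_e_eq (y : Circle) : ∃ s ∈ Set.Ico (0 : ℝ) 1, e s = y := by
  have h1 : e (Complex.arg y / (2 * Real.pi)) = y := by
    unfold e
    rw [mul_div_cancel₀ _ Real.two_pi_pos.ne', Circle.exp_arg]
  refine ⟨Int.fract (Complex.arg y / (2 * Real.pi)), ⟨Int.fract_nonneg _, Int.fract_lt_one _⟩, ?_⟩
  conv_rhs => rw [← h1]
  refine e_eq_e_iff.2 ⟨-⌊Complex.arg y / (2 * Real.pi)⌋, ?_⟩
  rw [Int.fract]
  push_cast
  ring

theorem e_mem_K_iff {s : ℝ} (hs : s ∈ Set.Ico (0 : ℝ) 1) : e s ∈ K ↔ s < 1 / 2 := by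
  constructor
  · rintro ⟨u, hu, h⟩
    rw [← e_injOn ⟨hu.1, hu.2.trans (by norm_num)⟩ hs h]
    exact hu.2
  · exact fun h => ⟨s, ⟨hs.1, h⟩, rfl⟩

theorem e_sq (s : ℝ) : e s ^ 2 = e (2 * s) := by
  unfold e
  rw [sq, ← Circle.exp_add]
  ring_nf

theorem circleAct_affine_one (t s : ℝ) : circleAct (affine t 1) (e s) = e (s + t) := by
  change e s ^ (1 : ℤ) * AddCircle.toCircle (t : UnitAddCircle) = _
  rw [AddCircle.toCircle_apply_mk, zpow_one, e, e, ← Circle.exp_add]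
  ring_nf

theorem circleAct_affine_neg_one (t s : ℝ) : circleAct (affine t (-1)) (e s) = e (-s + t) := by
  change e s ^ (-1 : ℤ) * AddCircle.toCircle (t : UnitAddCircle) = _
  rw [AddCircle.toCircle_apply_mk, zpow_neg_one, e, e, ← Circle.exp_neg, ← Circle.exp_add]
  ring_nf

theorem exists_affine_eq (g : G) : ∃ t ∈ Set.Ico (0 : ℝ) 1, ∃ v, affine t v = g := by
  obtain ⟨l, v⟩ := g
  have : Fact ((0 : ℝ) < 1) := ⟨zero_lt_one⟩
  obtain ⟨t, ht, h⟩ := AddCircle.eq_coe_Ico (p := (1 : ℝ)) (Multiplicative.toAdd l)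
  exact ⟨t, ht, v, by unfold affine; rw [h]; rfl⟩

/-! ### The sets `g X[ε]` -/

/-- The translate `g K` of the consonances. -/
def translate (g : G) : Set Circle := circleAct g '' K

theorem circleAct_injective (g : G) : Function.Injective (circleAct g) := by
  intro x y h
  have := (torusAct g).injective (a₁ := (1, x)) (a₂ := (1, y)) (Prod.ext rfl h)
  exact congrArg Prod.snd this

theorem torusAct_image_univ_prod (g : G) (A : Set Circle) :
    torusAct g '' (Set.univ ×ˢ A) = Set.univ ×ˢ (circleAct g '' A) := by
  ext z
  constructor
  · rintro ⟨w, hw, rfl⟩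
    exact ⟨trivial, w.2, hw.2, rfl⟩
  · rintro ⟨-, y, hy, hyz⟩
    refine ⟨(lin g.right z.1, y), ⟨trivial, hy⟩, Prod.ext ?_ hyz⟩
    change lin g.right (lin g.right z.1) = z.1
    rcases Int.units_eq_one_or g.right with h | h <;> simp [lin, h]

theorem torusAct_image_Keps (g : G) : torusAct g '' Keps = Set.univ ×ˢ translate g :=
  torusAct_image_univ_prod g K

theorem successorSet_eq (g : G) : successorSet g = Set.univ ×ˢ (translate g ∩ K) := by
  rw [successorSet, torusAct_image_Keps, Keps, Set.prod_inter_prod, Set.univ_inter]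

/-- `1/2 = -1/2` in `ℝ/ℤ`, so both signs fix the translation part of `q`, which is therefore
central. The commutation condition in `Admissible` is automatic. -/
theorem commute_quasipolarity (g : G) : Commute g quasipolarity := by
  have hneg : signAut g.right (Multiplicative.ofAdd (((1 / 2 : ℝ) : UnitAddCircle))) =
      Multiplicative.ofAdd (((1 / 2 : ℝ) : UnitAddCircle)) := by
    change (Multiplicative.ofAdd (((1 / 2 : ℝ) : UnitAddCircle))) ^ (g.right : ℤ) = _
    rcases Int.units_eq_one_or g.right with h | h
    · simp [h]
    · have h2 := congrArg SemidirectProduct.left quasipolarity_mul_self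
      have h3 : Multiplicative.ofAdd (((1 / 2 : ℝ) : UnitAddCircle)) *
          signAut 1 (Multiplicative.ofAdd (((1 / 2 : ℝ) : UnitAddCircle))) = 1 := h2
      rw [map_one, MulAut.one_apply] at h3
      rw [h, Units.val_neg, Units.val_one, zpow_neg_one]
      exact inv_eq_of_mul_eq_one_left h3
  ext1
  · change g.left * signAut g.right (Multiplicative.ofAdd (((1 / 2 : ℝ) : UnitAddCircle))) =
      Multiplicative.ofAdd (((1 / 2 : ℝ) : UnitAddCircle)) * signAut 1 g.left
    rw [hneg, map_one, MulAut.one_apply, mul_comm]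
  · exact mul_comm g.right 1

theorem admissible_iff (ξ : Torus) (g : G) : Admissible ξ g ↔ ξ.2 ∉ translate g := by
  have h : ξ ∈ torusAct g '' Deps ↔ ξ.2 ∉ translate g := by
    rw [Deps, torusAct_image_univ_prod, D, translate,
      Set.image_compl_eq ⟨circleAct_injective g, fun y => ?_⟩]
    · simp
    · obtain ⟨w, hw⟩ := (torusAct g).surjective (1, y)
      exact ⟨w.2, congrArg Prod.snd hw⟩
  exact ⟨fun ha => h.1 ha.mem, fun hn => ⟨h.2 hn, (commute_quasipolarity g).map torusAct⟩⟩

/-- The translate is `[t, t + 1/2)` modulo 1. The second alternative is the portion that wraps past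
1; it occurs only for `t > 1/2`, the first only for `t < 1/2`. -/
theorem e_mem_translate_one_iff {t s : ℝ} (ht : t ∈ Set.Ico (0 : ℝ) 1)
    (hs : s ∈ Set.Ico (0 : ℝ) (1 / 2)) :
    e s ∈ translate (affine t 1) ↔ t ≤ s ∨ s < t - 1 / 2 := by
  obtain ⟨ht0, ht1⟩ := ht
  obtain ⟨hs0, hs1⟩ := hs
  constructor
  · rintro ⟨_, ⟨u, ⟨hu0, hu1⟩, rfl⟩, h⟩
    have h' : e (u + t) = e s := (circleAct_affine_one t u).symm.trans h
    obtain ⟨m, hm⟩ := e_eq_e_iff.1 h'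
    rcases le_or_gt m 0 with h0 | h0
    · have : (m : ℝ) ≤ 0 := by exact_mod_cast h0
      left; linarith
    · have : (1 : ℝ) ≤ m := by exact_mod_cast h0
      right; linarith
  · rintro (h | h)
    · refine ⟨e (s - t), ⟨s - t, ⟨by linarith, by linarith⟩, rfl⟩, ?_⟩
      rw [circleAct_affine_one, sub_add_cancel]
    · refine ⟨e (s - t + 1), ⟨s - t + 1, ⟨by linarith, by linarith⟩, rfl⟩, ?_⟩
      rw [circleAct_affine_one]
      exact e_eq_e_iff.2 ⟨1, by push_cast; ring⟩

/-- The reflected arc is `(t - 1/2, t]`. Its shifts by nonzero integers miss `[0, 1/2)`, so there is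
no wrapped portion. -/
theorem e_mem_translate_neg_one_iff {t s : ℝ} (ht : t ∈ Set.Ico (0 : ℝ) 1)
    (hs : s ∈ Set.Ico (0 : ℝ) (1 / 2)) :
    e s ∈ translate (affine t (-1)) ↔ s ∈ Set.Ioc (t - 1 / 2) t := by
  obtain ⟨ht0, ht1⟩ := ht
  obtain ⟨hs0, hs1⟩ := hs
  constructor
  · rintro ⟨_, ⟨u, ⟨hu0, hu1⟩, rfl⟩, h⟩
    have h' : e (-u + t) = e s := (circleAct_affine_neg_one t u).symm.trans h
    obtain ⟨m, hm⟩ := e_eq_e_iff.1 h'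
    have h1 : (m : ℝ) < 1 := by linarith
    have h2 : (-1 : ℝ) < m := by linarith
    have h3 : m = 0 := by
      have h1' : m < 1 := by exact_mod_cast h1
      have h2' : -1 < m := by exact_mod_cast h2
      lia
    rw [h3] at hm
    push_cast at hm
    exact ⟨by linarith, by linarith⟩
  · rintro ⟨h1, h2⟩
    refine ⟨e (t - s), ⟨t - s, ⟨by linarith, by linarith⟩, rfl⟩, ?_⟩
    rw [circleAct_affine_neg_one]
    ring_nf

theorem translate_quasipolarity_inter_K : translate quasipolarity ∩ K = ∅ := by
  rw [Set.eq_empty_iff_forall_notMem]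
  rintro _ ⟨h, s, hs, rfl⟩
  rcases (e_mem_translate_one_iff (by norm_num) hs).1 h with h | h
  · linarith [hs.2]
  · linarith [hs.1]

theorem translate_inter_K_nonempty {g : G} (hg : g ≠ quasipolarity) :
    (translate g ∩ K).Nonempty := by
  obtain ⟨t, ht, v, rfl⟩ := exists_affine_eq g
  obtain ⟨ht0, ht1⟩ := ht
  suffices h : ∃ s ∈ Set.Ico (0 : ℝ) (1 / 2), e s ∈ translate (affine t v) by
    obtain ⟨s, hs, h⟩ := h
    exact ⟨e s, h, s, hs, rfl⟩
  rcases Int.units_eq_one_or v with rfl | rfl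
  · rcases lt_trichotomy t (1 / 2) with h | h | h
    · exact ⟨t, ⟨ht0, h⟩, (e_mem_translate_one_iff ⟨ht0, ht1⟩ ⟨ht0, h⟩).2 (Or.inl le_rfl)⟩
    · exact absurd (by rw [h]; rfl) hg
    · exact ⟨0, by norm_num, (e_mem_translate_one_iff ⟨ht0, ht1⟩ (by norm_num)).2
        (Or.inr (by linarith))⟩
  -- `t / 2` is a fixed point of the reflection `s ↦ t - s`.
  · have hs : t / 2 ∈ Set.Ico (0 : ℝ) (1 / 2) := ⟨by linarith, by linarith⟩
    exact ⟨t / 2, hs, (e_mem_translate_neg_one_iff ⟨ht0, ht1⟩ hs).2 ⟨by linarith, by linarith⟩⟩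

theorem isPreconnected_translate_inter_K (g : G) : IsPreconnected (translate g ∩ K) := by
  obtain ⟨t, ht, v, rfl⟩ := exists_affine_eq g
  set I : Set ℝ := {s ∈ Set.Ico (0 : ℝ) (1 / 2) | e s ∈ translate (affine t v)} with hI
  have h1 : translate (affine t v) ∩ K = e '' I := by
    ext y
    constructor
    · rintro ⟨h, s, hs, rfl⟩
      exact ⟨s, ⟨hs, h⟩, rfl⟩
    · rintro ⟨s, ⟨hs, h⟩, rfl⟩
      exact ⟨h, s, hs, rfl⟩
  rw [h1]
  refine IsPreconnected.image (Set.OrdConnected.isPreconnected ?_) _ continuous_e.continuousOn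
  refine ⟨fun a ha b hb c hc => ?_⟩
  obtain ⟨ha, ha'⟩ := ha
  obtain ⟨hb, hb'⟩ := hb
  have hcI : c ∈ Set.Ico (0 : ℝ) (1 / 2) := ⟨ha.1.trans hc.1, hc.2.trans_lt hb.2⟩
  refine ⟨hcI, ?_⟩
  rcases Int.units_eq_one_or v with rfl | rfl
  · rw [e_mem_translate_one_iff ht] at ha' hb' ⊢ <;> try assumption
    rcases ha' with h | h
    · exact Or.inl (h.trans hc.1)
    · rcases hb' with h' | h'
      · linarith [ha.1, hb.2]
      · exact Or.inr (hc.2.trans_lt h')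
  · rw [e_mem_translate_neg_one_iff ht] at ha' hb' ⊢ <;> try assumption
    exact ⟨ha'.1.trans_le hc.1, hc.2.trans hb'.2⟩

theorem successorSet_eq_empty_iff (g : G) : successorSet g = ∅ ↔ g = quasipolarity := by
  rw [successorSet_eq]
  constructor
  · intro h
    by_contra hg
    obtain ⟨y, hy⟩ := translate_inter_K_nonempty hg
    exact (Set.eq_empty_iff_forall_notMem.1 h (1, y)) ⟨trivial, hy⟩
  · rintro rfl
    rw [translate_quasipolarity_inter_K, Set.prod_empty]

theorem torusAct_image_Keps_eq_Deps_iff (g : G) :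
    torusAct g '' Keps = Deps ↔ g = quasipolarity := by
  constructor
  · intro h
    rw [← successorSet_eq_empty_iff, successorSet, h, Set.eq_empty_iff_forall_notMem]
    exact fun z hz => hz.1.2 hz.2.2
  · rintro rfl
    rw [torusAct_image_Keps, Deps]
    congr 1
    refine Set.Subset.antisymm (fun y hy hK => ?_) fun y hy => ?_
    · exact Set.eq_empty_iff_forall_notMem.1 translate_quasipolarity_inter_K y ⟨hy, hK⟩
    · obtain ⟨s, hs, rfl⟩ := exists_e_eq y
      have hs' : 1 / 2 ≤ s := not_lt.1 fun h => hy ((e_mem_K_iff hs).2 h)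
      refine ⟨e (s - 1 / 2), ⟨s - 1 / 2, ⟨by linarith, by linarith [hs.2]⟩, rfl⟩, ?_⟩
      rw [quasipolarity, circleAct_affine_one, sub_add_cancel]

theorem exists_translate {y k : Circle} (hy : y ∈ K) (hk : k ∈ K) (hyk : y ≠ k) :
    ∃ g, k ∉ translate g ∧ y ∈ translate g := by
  obtain ⟨s, hs, rfl⟩ := hy
  obtain ⟨r, hr, rfl⟩ := hk
  change e s ≠ e r at hyk
  have hsr : s ≠ r := fun h => hyk (by rw [h])
  -- If `s < r`, the arc `[r + 1/2, r + 1)` ends just before `r` and wraps over `s`; if `s > r`, the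
  -- arc `[s, s + 1/2)` starts after `r`.
  rcases lt_or_gt_of_ne hsr with h | h
  · have ht : r + 1 / 2 ∈ Set.Ico (0 : ℝ) 1 := ⟨by linarith [hr.1], by linarith [hr.2]⟩
    refine ⟨affine (r + 1 / 2) 1, fun hm => ?_, (e_mem_translate_one_iff ht hs).2
      (Or.inr (by linarith))⟩
    rcases (e_mem_translate_one_iff ht hr).1 hm with h | h <;> linarith
  · have ht : s ∈ Set.Ico (0 : ℝ) 1 := ⟨hs.1, by linarith [hs.2]⟩
    refine ⟨affine s 1, fun hm => ?_, (e_mem_translate_one_iff ht hs).2 (Or.inl le_rfl)⟩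
    rcases (e_mem_translate_one_iff ht hr).1 hm with h | h <;> linarith [hr.1, hs.2]

theorem exists_mem_K_ne (k : Circle) : ∃ y ∈ K, y ≠ k := by
  by_cases h : k = e 0
  · refine ⟨e (1 / 4), ⟨1 / 4, by norm_num, rfl⟩, fun h' => ?_⟩
    have := e_injOn (by norm_num) (by norm_num) (h'.trans h)
    norm_num at this
  · exact ⟨e 0, ⟨0, by norm_num, rfl⟩, Ne.symm h⟩

/-- `K` contains no two antipodal points. So passing to `τ_q` identifies no points of `X[ε]`,
although its subspace topology changes. -/
theorem sq_injOn_K : Set.InjOn (fun y : Circle => y ^ 2) K := by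
  rintro _ ⟨s, hs, rfl⟩ _ ⟨r, hr, rfl⟩ h
  have h' : e (2 * s) = e (2 * r) := by rw [← e_sq, ← e_sq]; exact h
  have := e_injOn ⟨by linarith [hs.1], by linarith [hs.2]⟩ ⟨by linarith [hr.1], by linarith [hr.2]⟩ h'
  rw [show s = r by linarith]

/-! ### The topologies on the torus -/

/-- Squaring of the discantus interval. -/
noncomputable def sqSnd (z : Torus) : Torus := (z.1, z.2 ^ 2)

theorem continuous_sqSnd : Continuous sqSnd := by unfold sqSnd; fun_prop

theorem torusAct_quasipolarity_apply (z : Torus) :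
    torusAct quasipolarity z = (z.1, z.2 * Circle.exp Real.pi) := by
  obtain ⟨s, -, hs⟩ := exists_e_eq z.2
  refine Prod.ext (zpow_one z.1) ?_
  change circleAct (affine (1 / 2) 1) z.2 = z.2 * Circle.exp Real.pi
  rw [← hs, circleAct_affine_one, e, e, ← Circle.exp_add]
  ring_nf

theorem sqSnd_eq_iff (z w : Torus) :
    sqSnd z = sqSnd w ↔ z = w ∨ z = torusAct quasipolarity w := by
  rw [torusAct_quasipolarity_apply, sqSnd, sqSnd, Prod.mk.injEq, Prod.ext_iff, Prod.ext_iff,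
    ← and_or_left]
  refine and_congr_right fun _ => ?_
  simp only [Circle.ext_iff, Circle.coe_pow, Circle.coe_mul, Circle.coe_exp, Complex.exp_pi_mul_I,
    mul_neg_one]
  exact sq_eq_sq_iff_eq_or_eq_neg

/-- The closed sets of `τ_q` are the standard closed sets stable under `q`. The fibres of `sqSnd`
are the `q`-orbits, so these sets are saturated, and by compactness their images are closed. -/
theorem kuratowskiTopology_eq : kuratowskiTopology = standardTopology.induced sqSnd := by
  refine TopologicalSpace.ext_iff_isClosed.2 fun A => ?_
  rw [isClosed_induced_iff]
  have hA : @IsClosed _ kuratowskiTopology A ↔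
      closure A ∪ torusAct quasipolarity '' closure A = A := by
    rw [← @isOpen_compl_iff]
    change closure Aᶜᶜ ∪ torusAct quasipolarity '' closure Aᶜᶜ = Aᶜᶜ ↔ _
    rw [compl_compl]
  rw [hA]
  constructor
  · intro h
    have h1 : closure A ⊆ A := Set.subset_union_left.trans h.le
    have h2 : torusAct quasipolarity '' A ⊆ A :=
      (Set.image_mono subset_closure).trans (Set.subset_union_right.trans h.le)
    have hcl : IsClosed A := isClosed_of_closure_subset h1
    refine ⟨sqSnd '' A, (hcl.isCompact.image continuous_sqSnd).isClosed,
      Set.Subset.antisymm ?_ (Set.subset_preimage_image _ _)⟩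
    rintro z ⟨w, hw, hwz⟩
    rcases (sqSnd_eq_iff z w).1 hwz.symm with rfl | rfl
    · exact hw
    · exact h2 ⟨w, hw, rfl⟩
  · rintro ⟨B, hB, rfl⟩
    rw [(hB.preimage continuous_sqSnd).closure_eq]
    refine Set.union_eq_self_of_subset_right ?_
    rintro _ ⟨w, hw, rfl⟩
    rw [Set.mem_preimage, (sqSnd_eq_iff _ w).2 (Or.inr rfl)]
    exact hw

theorem sqSnd_surjective : Function.Surjective sqSnd := by
  rintro ⟨x, y⟩
  obtain ⟨s, -, rfl⟩ := exists_e_eq y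
  refine ⟨(x, e (s / 2)), Prod.ext rfl ?_⟩
  change e (s / 2) ^ 2 = e s
  rw [e_sq, mul_div_cancel₀ _ two_ne_zero]

theorem isInducing_sqSnd :
    Topology.IsInducing fun z : TorusWith kuratowskiTopology => sqSnd z.point :=
  ⟨kuratowskiTopology_eq⟩

theorem nonempty_separationQuotient_torus :
    Nonempty (SeparationQuotient (TorusWith kuratowskiTopology) ≃ₜ Torus) :=
  isInducing_sqSnd.nonempty_separationQuotient_homeomorph sqSnd_surjective

theorem nonempty_separationQuotient_fibre (x : Circle) :
    Nonempty (SeparationQuotient (SubspaceOf kuratowskiTopology (fibre x)) ≃ₜ RP1) := by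
  let f : SubspaceOf kuratowskiTopology (fibre x) → Circle := fun z => (sqSnd z.1.point).2
  have hf : Topology.IsInducing f := by
    have h1 := isInducing_sqSnd.comp
      (Topology.IsInducing.subtypeVal
        (t := {z : TorusWith kuratowskiTopology | z.point ∈ fibre x}))
    have h2 : Topology.IsInducing fun y : Circle => (x, y) := (isEmbedding_prodMkRight x).isInducing
    refine h2.of_comp_iff.1 ?_
    have h3 : (fun y : Circle => (x, y)) ∘ f = fun z => sqSnd z.1.point :=
      funext fun z => Prod.ext z.2.1.symm rfl
    rw [h3]
    exact h1
  have hs : Function.Surjective f := fun y => by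
    obtain ⟨z, hz⟩ := sqSnd_surjective (x, y)
    exact ⟨⟨z, congrArg Prod.fst hz, trivial⟩, congrArg Prod.snd hz⟩
  obtain ⟨a⟩ := hf.nonempty_separationQuotient_homeomorph hs
  obtain ⟨b⟩ := nonempty_RP1_homeomorph_circle
  exact ⟨a.trans b.symm⟩

/-- If the topology `τ` is induced by `id × p` and `p` is injective on `J`, then `S¹ × J` is a
product of subspaces. -/
theorem nonempty_subspaceOf_homeomorph (τ : TopologicalSpace Torus) (p : Circle → Circle)
    (hτ : τ = standardTopology.induced (Prod.map id p)) {J : Set Circle} (hJ : Set.InjOn p J) :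
    Nonempty (SubspaceOf τ (Set.univ ×ˢ J) ≃ₜ Circle × (p '' J)) := by
  subst hτ
  let f : SubspaceOf (standardTopology.induced (Prod.map id p)) (Set.univ ×ˢ J) → Circle × (p '' J) :=
    fun z => (z.1.point.1, ⟨p z.1.point.2, z.1.point.2, z.2.2, rfl⟩)
  have hi : Topology.IsInducing f := by
    have h1 : Topology.IsInducing fun z : TorusWith (standardTopology.induced (Prod.map id p)) =>
        Prod.map id p z.point := ⟨rfl⟩
    have h2 := h1.comp (Topology.IsInducing.subtypeVal
      (t := {z : TorusWith _ | z.point ∈ Set.univ ×ˢ J}))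
    have h3 : Topology.IsInducing (Prod.map id Subtype.val : Circle × (p '' J) → Torus) :=
      Topology.IsInducing.id.prodMap Topology.IsInducing.subtypeVal
    exact h3.of_comp_iff.1 h2
  have hb : Function.Bijective f := by
    constructor
    · intro z w h
      have h1 : z.1.point.1 = w.1.point.1 := congrArg (fun q : Circle × (p '' J) => q.1) h
      have h2 : p z.1.point.2 = p w.1.point.2 :=
        congrArg (fun q : Circle × (p '' J) => (q.2 : Circle)) h
      exact Subtype.ext (Prod.ext h1 (hJ z.2.2 w.2.2 h2))
    · rintro ⟨x, _, y, hy, rfl⟩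
      exact ⟨⟨(x, y), trivial, hy⟩, rfl⟩
  exact ⟨(Equiv.ofBijective f hb).toHomeomorphOfIsInducing hi⟩

theorem exists_inducing_map {τ : TopologicalSpace Torus}
    (hτ : τ = standardTopology ∨ τ = kuratowskiTopology) :
    ∃ p : Circle → Circle, Continuous p ∧ Set.InjOn p K ∧
      τ = standardTopology.induced (Prod.map id p) := by
  rcases hτ with rfl | rfl
  · exact ⟨id, continuous_id, Set.injOn_id _, by rw [Prod.map_id, induced_id]⟩
  · exact ⟨fun y => y ^ 2, by fun_prop, sq_injOn_K, kuratowskiTopology_eq⟩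

theorem nonempty_homotopyEquiv_circle {τ : TopologicalSpace Torus}
    (hτ : τ = standardTopology ∨ τ = kuratowskiTopology) {ξ : Torus} (hξ : ξ ∈ Keps) {g : G}
    (hg : Admissible ξ g) (hq : g ≠ quasipolarity) :
    Nonempty (SubspaceOf τ (successorSet g) ≃ₕ Circle) := by
  obtain ⟨p, hpc, hpi, hp⟩ := exists_inducing_map hτ
  obtain ⟨a⟩ := nonempty_subspaceOf_homeomorph τ p hp (J := translate g ∩ K)
    (hpi.mono Set.inter_subset_right)
  have hconn : IsConnected (p '' (translate g ∩ K)) :=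
    IsConnected.image ⟨translate_inter_K_nonempty hq, isPreconnected_translate_inter_K g⟩ p
      hpc.continuousOn
  -- Admissibility is essential here: squaring maps all of `K` onto the circle, so `p(J)` need not
  -- be contractible for arbitrary `g`.
  have hmiss : p ξ.2 ∉ p '' (translate g ∩ K) := by
    rintro ⟨y, hy, h⟩
    rw [hpi hy.2 hξ.2 h] at hy
    exact (admissible_iff ξ g).1 hg hy.1
  have := Circle.contractibleSpace_of_isConnected hconn hmiss
  obtain ⟨b⟩ := ContractibleSpace.hequiv_unit (p '' (translate g ∩ K))
  rw [successorSet_eq]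
  exact ⟨(a.toHomotopyEquiv.trans
    ((ContinuousMap.HomotopyEquiv.refl Circle).prodCongr b)).trans
    (Homeomorph.prodPUnit Circle).toHomotopyEquiv⟩

/-! ### Homological symmetries -/

theorem rank_H1_successorSet_quasipolarity (τ : TopologicalSpace Torus) :
    Module.rank ℤ (H1 (SubspaceOf τ (successorSet quasipolarity))) = 0 := by
  have : IsEmpty (SubspaceOf τ (successorSet quasipolarity)) :=
    ⟨fun z => Set.eq_empty_iff_forall_notMem.1
      ((successorSet_eq_empty_iff quasipolarity).2 rfl) _ z.2⟩
  exact rank_H1_of_isEmpty _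

theorem rank_H1_successorSet {τ : TopologicalSpace Torus}
    (hτ : τ = standardTopology ∨ τ = kuratowskiTopology) {ξ : Torus} (hξ : ξ ∈ Keps) {g : G}
    (hg : Admissible ξ g) (hq : g ≠ quasipolarity) :
    Module.rank ℤ (H1 (SubspaceOf τ (successorSet g))) = 1 := by
  obtain ⟨a⟩ := nonempty_homotopyEquiv_circle hτ hξ hg hq
  obtain ⟨i⟩ := H1_iso_of_homotopyEquiv_circle a
  exact rank_eq_one_of_iso i

theorem exists_admissible {ξ z : Torus} (hξ : ξ ∈ Keps) (hz : z ∈ Keps) (hne : z.2 ≠ ξ.2) :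
    ∃ g, Admissible ξ g ∧ g ≠ quasipolarity ∧ z ∈ successorSet g := by
  obtain ⟨g, hg, hzg⟩ := exists_translate hz.2 hξ.2 hne
  have hmem : z ∈ successorSet g := by
    rw [successorSet_eq]
    exact ⟨trivial, hzg, hz.2⟩
  refine ⟨g, (admissible_iff ξ g).2 hg, ?_, hmem⟩
  rw [ne_eq, ← successorSet_eq_empty_iff]
  exact Set.Nonempty.ne_empty ⟨z, hmem⟩

theorem isHomologicalSymmetry_iff {τ : TopologicalSpace Torus}
    (hτ : τ = standardTopology ∨ τ = kuratowskiTopology) {ξ : Torus} (hξ : ξ ∈ Keps) (g : G) :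
    IsHomologicalSymmetry τ ξ g ↔ Admissible ξ g ∧ g ≠ quasipolarity := by
  constructor
  · refine fun h => ⟨h.admissible, ?_⟩
    rintro rfl
    -- `q` has rank 0; it fails to be maximal because some other admissible element exists, with
    -- rank 1.
    obtain ⟨y, hy, hne⟩ := exists_mem_K_ne ξ.2
    obtain ⟨g, hg, hq, -⟩ := exists_admissible (z := (1, y)) hξ ⟨trivial, hy⟩ hne
    have := h.maximal g hg
    rw [rank_H1_successorSet_quasipolarity, rank_H1_successorSet hτ hξ hg hq] at this
    exact absurd this (by simp)
  · rintro ⟨hg, hq⟩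
    refine ⟨hg, fun h hh => ?_⟩
    rw [rank_H1_successorSet hτ hξ hg hq]
    by_cases hhq : h = quasipolarity
    · rw [hhq, rank_H1_successorSet_quasipolarity]
      exact zero_le_one
    · rw [rank_H1_successorSet hτ hξ hh hhq]

theorem admittedSuccessors_eq {τ : TopologicalSpace Torus}
    (hτ : τ = standardTopology ∨ τ = kuratowskiTopology) {ξ : Torus} (hξ : ξ ∈ Keps) :
    admittedSuccessors τ ξ = {z ∈ Keps | z.2 ≠ ξ.2} := by
  ext z
  constructor
  · rintro ⟨g, hg, hz⟩
    have hz' := hz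
    rw [successorSet_eq] at hz'
    refine ⟨hz.2, fun h => (admissible_iff ξ g).1 hg.admissible ?_⟩
    rw [← h]
    exact hz'.2.1
  · rintro ⟨hz, hne⟩
    obtain ⟨g, hg, hq, hzg⟩ := exists_admissible hξ hz hne
    exact ⟨g, (isHomologicalSymmetry_iff hτ hξ g).2 ⟨hg, hq⟩, hzg⟩

end ContinuousCounterpoint

open ContinuousCounterpoint in
theorem mainTheorem5 :
    -- `T` with the closure operator induced by `e^{1/2} 1` is, after identification of
    -- topologically indistinguishable points, homeomorphic to `T`; so is each section to `ℝP¹ ≅ S¹`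
    Nonempty (SeparationQuotient (TorusWith kuratowskiTopology) ≃ₜ Torus) ∧
    (∀ x : Circle,
      Nonempty (SeparationQuotient (SubspaceOf kuratowskiTopology (fibre x)) ≃ₜ RP1)) ∧
    Nonempty (RP1 ≃ₜ Circle) ∧
    -- `e^{1/2} 1` is the self-complementary map, and the only one with empty intersection
    (∀ g : G, torusAct g '' Keps = Deps ↔ g = quasipolarity) ∧
    (∀ g : G, successorSet g = ∅ ↔ g = quasipolarity) ∧
    -- for both topologies and every consonant interval
    (∀ τ : TopologicalSpace Torus, τ = standardTopology ∨ τ = kuratowskiTopology →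
      ∀ ξ ∈ Keps,
        (∀ g : G, Admissible ξ g → g ≠ quasipolarity →
          Nonempty (SubspaceOf τ (successorSet g) ≃ₕ Circle) ∧
          Nonempty (H1 (SubspaceOf τ (successorSet g)) ≅ ModuleCat.of ℤ ℤ)) ∧
        (∀ g : G, IsHomologicalSymmetry τ ξ g ↔ Admissible ξ g ∧ g ≠ quasipolarity) ∧
        admittedSuccessors τ ξ = {z ∈ Keps | z.2 ≠ ξ.2}) := by
  exact ⟨nonempty_separationQuotient_torus, nonempty_separationQuotient_fibre,
    nonempty_RP1_homeomorph_circle, torusAct_image_Keps_eq_Deps_iff, successorSet_eq_empty_iff,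
    fun τ hτ ξ hξ => ⟨fun g hg hq =>
      have h := nonempty_homotopyEquiv_circle hτ hξ hg hq
      ⟨h, h.elim H1_iso_of_homotopyEquiv_circle⟩,
      isHomologicalSymmetry_iff hτ hξ, admittedSuccessors_eq hτ hξ⟩⟩
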